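/- Let $n,r\ge 0$ and let $\sigma(\mathbf y)=\sum_{i=1}^{r}\omega_i(\mathbf y)\,\mathbf e_{\xi_i}(\mathbf y)\in\mathbb C[[y_1,\dots,y_n]]$, where $\omega_i\in\mathbb C[\mathbf y]\setminus\{0\}$, the points $\xi_i\in\mathbb C^n$ are pairwise distinct, and $\mathbf e_{\xi}(\mathbf y)=\sum_{\alpha\in\mathbb N^n}\xi^\alpha\frac{\mathbf y^\alpha}{\alpha!}$. A series $\tau=\sum_\alpha\tau_\alpha\frac{\mathbf y^\alpha}{\alpha!}$ acts on polynomials $p=\sum_\alpha p_\alpha\mathbf x^\alpha\in\mathbb C[\mathbf x]=\mathbb C[x_1,\dots,x_n]$ by $\langle\tau\mid p\rangle=\sum_\alpha p_\alpha\tau_\alpha$, and for $g\in\mathbb C[\mathbf x]$ the series $g\star\tau$ is defined by $\langle g\star\tau\mid q\rangle=\langle\tau\mid gq\rangle$ for all $q\in\mathbb C[\mathbf x]$. Let $I_\sigma=\{p\in\mathbb C[\mathbf x]\mid\forall q\in\mathbb C[\mathbf x],\ \langle\sigma\mid pq\rangle=0\}$, an ideal, and $\mathcal A_\sigma=\mathbb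 C[\mathbf x]/I_\sigma$. For $\omega\in\mathbb C[\mathbf y]$ let $\mu(\omega)$ be the dimension of the space spanned by $\omega$ and all its partial derivatives $\partial^\alpha\omega$, $\alpha\in\mathbb N^n$. Then $\mathcal A_\sigma$ is finite-dimensional over $\mathbb C$. Let $B=(b_1,\dots,b_m)$ and $B'=(b_1',\dots,b_m')$ be families of polynomials whose classes are bases of $\mathcal A_\sigma$. Let $H_\tau^{B,B'}=(\langle\tau\mid b_ib_j'\rangle)_{1\le i,j\le m}$ and let $M_g^{B}$, $M_g^{B'}$ be the matrices of multiplication by $g$ on $\mathcal A_\sigma$ in the bases $B$, $B'$ (the $j$-th column holds the coordinates of the product of $g$ with the $j$-th basis element). The matrix $H_\sigma^{B,B'}$ is invertible, and: 1. For every $g\in\mathbb C[\mathbf x]$, $M_g^{B'}=(H_\sigma^{B,B'})^{-1}H_{g\star\sigma}^{B,B'}$ and $(M_g^{B})^{\mathsf T}=H_{g\star\sigma}^{B,B'}(H_\sigma^{B,B'})^{-1}$. 2. For every $g\in\mathbb C[\mathbf x]$, the generalized eigenvalues of the pencil $(H_{g\star\sigma}^{B,B'},H_\sigma^{B,B'})$,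 i.e. the $z\in\mathbb C$ for which $H_{g\star\sigma}^{B,B'}v=z\,H_\sigma^{B,B'}v$ for some $v\ne0$, are exactly the values $g(\xi_1),\dots,g(\xi_r)$. The polynomial $\det(H_{g\star\sigma}^{B,B'}-t\,H_\sigma^{B,B'})$ in $t$ is nonzero, and its multiset of roots consists of the values $g(\xi_i)$, $i=1,\dots,r$, each taken $\mu(\omega_i)$ times (the multiplicities of indices $i$ with the same value $g(\xi_i)$ add up). 3. A vector $v\in\mathbb C^m$ is a generalized eigenvector common to all the pencils $(H_{g\star\sigma}^{B,B'},H_\sigma^{B,B'})$, $g\in\mathbb C[\mathbf x]$ (that is, $v\ne0$ and for every $g$ there is $z\in\mathbb C$ with $H_{g\star\sigma}^{B,B'}v=z\,H_\sigma^{B,B'}v$) if and only if $v=c\,(H_\sigma^{B,B'})^{-1}B(\xi_i)$ for some $i\in\{1,\dots,r\}$ and some $c\in\mathbb C\setminus\{0\}$, where $B(\xi_i)=(b_1(\xi_i),\dots,b_m(\xi_i))^{\mathsf T}$. -/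

import Mathlib

namespace Hankel

noncomputable section

/-- The multi-factorial `α! = α₁! ⋯ αₙ!`. -/
def multiFactorial {n : ℕ} (α : Fin n →₀ ℕ) : ℕ := ∏ i, (α i).factorial

theorem multiFactorial_ne_zero {n : ℕ} (α : Fin n →₀ ℕ) : (multiFactorial α : ℂ) ≠ 0 := by
  unfold multiFactorial
  exact_mod_cast Finset.prod_ne_zero_iff.mpr fun i _ => (α i).factorial_ne_zero

/-- The moments `σ_α` of a formal power series `σ(y) = ∑ σ_α y^α / α!`. -/
def moment {n : ℕ} (σ : MvPowerSeries (Fin n) ℂ) (α : Fin n →₀ ℕ) : ℂ :=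
  (multiFactorial α : ℂ) * MvPowerSeries.coeff α σ

/-- The series `σ` as a linear functional on polynomials: the linear map
`p = ∑ p_α x^α ↦ ⟨σ | p⟩ = ∑ p_α σ_α`. -/
def pairing {n : ℕ} (σ : MvPowerSeries (Fin n) ℂ) : MvPolynomial (Fin n) ℂ →ₗ[ℂ] ℂ :=
  (MvPolynomial.basisMonomials (Fin n) ℂ).constr ℂ (moment σ)

theorem pairing_monomial {n : ℕ} (σ : MvPowerSeries (Fin n) ℂ) (α : Fin n →₀ ℕ) :
    pairing σ (MvPolynomial.monomial α 1) = moment σ α := by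
  have h := (MvPolynomial.basisMonomials (Fin n) ℂ).constr_basis ℂ (moment σ) α
  rwa [MvPolynomial.coe_basisMonomials] at h

/-- The series `p ⋆ σ`, whose moments are `⟨p ⋆ σ | x^β⟩ = ⟨σ | p x^β⟩`. -/
def starAct {n : ℕ} (p : MvPolynomial (Fin n) ℂ) (σ : MvPowerSeries (Fin n) ℂ) :
    MvPowerSeries (Fin n) ℂ :=
  fun β => pairing σ (p * MvPolynomial.monomial β 1) / (multiFactorial β : ℂ)

theorem pairing_starAct {n : ℕ} (p : MvPolynomial (Fin n) ℂ) (σ : MvPowerSeries (Fin n) ℂ)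
    (q : MvPolynomial (Fin n) ℂ) : pairing (starAct p σ) q = pairing σ (p * q) := by
  have h : pairing (starAct p σ) = (pairing σ).comp (LinearMap.mulLeft ℂ p) := by
    refine (MvPolynomial.basisMonomials (Fin n) ℂ).ext fun β => ?_
    rw [MvPolynomial.coe_basisMonomials]
    rw [pairing_monomial]
    exact mul_div_cancel₀ _ (multiFactorial_ne_zero β)
  rw [h]
  rfl

/-- The ideal `I_σ = {p | ∀ q, ⟨σ | p q⟩ = 0}`. -/
def hankelIdeal {n : ℕ} (σ : MvPowerSeries (Fin n) ℂ) : Ideal (MvPolynomial (Fin n) ℂ) where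
  carrier := {p | ∀ q, pairing σ (p * q) = 0}
  zero_mem' := fun q => by simp
  add_mem' := fun {a b} ha hb q => by
    rw [add_mul, map_add, ha q, hb q, add_zero]
  smul_mem' := fun c a ha q => by
    rw [smul_eq_mul, mul_comm c a, mul_assoc]
    exact ha (c * q)

/-- `I_σ` is the kernel of the Hankel operator `p ↦ p ⋆ σ`. -/
theorem mem_hankelIdeal_iff {n : ℕ} (σ : MvPowerSeries (Fin n) ℂ) (p : MvPolynomial (Fin n) ℂ) :
    p ∈ hankelIdeal σ ↔ starAct p σ = 0 := by
  constructor
  · intro h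
    funext β
    change pairing σ (p * MvPolynomial.monomial β 1) / (multiFactorial β : ℂ) = 0
    rw [h, zero_div]
  · intro h q
    rw [← pairing_starAct, h]
    have h0 : pairing (0 : MvPowerSeries (Fin n) ℂ) = 0 := by
      refine (MvPolynomial.basisMonomials (Fin n) ℂ).ext fun β => ?_
      rw [MvPolynomial.coe_basisMonomials]
      rw [pairing_monomial]
      simp [moment]
    rw [h0]
    rfl

/-- The quotient algebra `A_σ = ℂ[x] / I_σ`. -/
abbrev HankelAlgebra {n : ℕ} (σ : MvPowerSeries (Fin n) ℂ) : Type :=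
  MvPolynomial (Fin n) ℂ ⧸ hankelIdeal σ

/-- The family of polynomials `B` is (represents) a basis of `A_σ`. -/
structure IsBasis {n m : ℕ} (σ : MvPowerSeries (Fin n) ℂ)
    (B : Fin m → MvPolynomial (Fin n) ℂ) : Prop where
  linearIndependent :
    LinearIndependent ℂ fun i => (Ideal.Quotient.mk (hankelIdeal σ) (B i) : HankelAlgebra σ)
  span :
    ⊤ ≤ Submodule.span ℂ
      (Set.range fun i => (Ideal.Quotient.mk (hankelIdeal σ) (B i) : HankelAlgebra σ))

/-- The matrix `M_g^B` of multiplication by `g` in the basis `B` of `A_σ`: its `j`-th column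
holds the coordinates of `g b_j`. -/
def mulMatrix {n m : ℕ} {σ : MvPowerSeries (Fin n) ℂ} {B : Fin m → MvPolynomial (Fin n) ℂ}
    (hB : IsBasis σ B) (g : MvPolynomial (Fin n) ℂ) : Matrix (Fin m) (Fin m) ℂ :=
  LinearMap.toMatrix (Module.Basis.mk hB.linearIndependent hB.span)
    (Module.Basis.mk hB.linearIndependent hB.span)
    (LinearMap.mulLeft ℂ (Ideal.Quotient.mk (hankelIdeal σ) g : HankelAlgebra σ))

/-- The Hankel matrix `H_σ^{U,V} = (⟨σ | u_i v_j⟩)`. -/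
def hankelMatrix {n l m : ℕ} (σ : MvPowerSeries (Fin n) ℂ)
    (U : Fin l → MvPolynomial (Fin n) ℂ) (V : Fin m → MvPolynomial (Fin n) ℂ) :
    Matrix (Fin l) (Fin m) ℂ :=
  Matrix.of fun i j => pairing σ (U i * V j)

/-- The exponential series `e_ξ(y) = ∑ ξ^α y^α / α!`. -/
def expSeries {n : ℕ} (ξ : Fin n → ℂ) : MvPowerSeries (Fin n) ℂ :=
  fun α => (∏ i, ξ i ^ α i) / (multiFactorial α : ℂ)

/-- The polynomial-exponential series `∑ ω_i(y) e_{ξ_i}(y)`. -/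
def polyExp {n r : ℕ} (ω : Fin r → MvPolynomial (Fin n) ℂ) (ξ : Fin r → Fin n → ℂ) :
    MvPowerSeries (Fin n) ℂ :=
  ∑ i, (ω i : MvPowerSeries (Fin n) ℂ) * expSeries (ξ i)

/-- The iterated derivative `∂₁^{α₁} ⋯ ∂ₙ^{αₙ} ω`. -/
def iterPDeriv {n : ℕ} (α : Fin n →₀ ℕ) (ω : MvPolynomial (Fin n) ℂ) : MvPolynomial (Fin n) ℂ :=
  (List.ofFn fun i : Fin n =>
    ((MvPolynomial.pderiv i).toLinearMap : Module.End ℂ (MvPolynomial (Fin n) ℂ)) ^ α i).prod ω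

/-- `μ(ω)`: the dimension of the space spanned by `ω` and all its derivatives. -/
def mult {n : ℕ} (ω : MvPolynomial (Fin n) ℂ) : ℕ :=
  Module.finrank ℂ (Submodule.span ℂ (Set.range fun α : Fin n →₀ ℕ => iterPDeriv α ω))

/-- `v` is a generalized eigenvector of the pencil `(P, Q)` for the value `z`. -/
def IsGenEigenpair {m : ℕ} (P Q : Matrix (Fin m) (Fin m) ℂ) (z : ℂ) (v : Fin m → ℂ) : Prop :=
  v ≠ 0 ∧ P.mulVec v = z • Q.mulVec v

/-- The polynomial `det (P - t Q)` in `t`; its roots, with their multiplicities, are the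
generalized eigenvalues of the pencil `(P, Q)`, with their multiplicities. -/
def pencilPoly {m : ℕ} (P Q : Matrix (Fin m) (Fin m) ℂ) : Polynomial ℂ :=
  (P.map Polynomial.C - (Polynomial.X : Polynomial ℂ) • Q.map Polynomial.C).det

end

end Hankel

open Hankel

namespace Hankel

noncomputable section

open MvPolynomial
open scoped IsMulCommutative

/-! Multiplication by `X j` acts on series as ∂_j, and ∂_j(ω e_ξ) = ((∂_j + ξ_j) ω) e_ξ. Hence ⟨ω
e_ξ | p⟩ is the constant term of p(∂ + ξ) ω, and everything rests on the ideals I_i = {p | p(∂ +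
ξ_i) ω_i = 0} (`annIdeal`). The quotient by I_i is the span of the derivatives of ω_i, of dimension
μ(ω_i); since ∂_j is nilpotent on ω_i, any g acts on it as g(ξ_i) plus a nilpotent.

Distinct points give coprime ideals, and I_σ = ⋂ I_i (`hankelIdeal_polyExp`). By the Chinese
remainder theorem A_σ is the product of these quotients, so multiplication by g has characteristic
polynomial ∏ (t - g(ξ_i))^μ(ω_i) (`charpoly_mulLeft`).

The Hankel matrix H is the Gram matrix of the form (a, b) ↦ ⟨σ | ab⟩, which is nondegenerate on A_σ
by the definition of I_σ. Moving g to either argument gives H_{g⋆σ} = H M_g^{B'} = (M_g^B)ᵀ H. The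
first form reduces the pencil to the spectrum of M_g^{B'}. By the second, v is a common eigenvector
exactly when Hv is one for all (M_g^B)ᵀ, that is, when Hv represents a nonzero multiple of a
character of A_σ; the characters are the evaluations at the ξ_i (`exists_eq_smul_eval`). -/

/-! ### Differential operators with constant coefficients -/

theorem pderiv_pderiv_comm {n : ℕ} (i j : Fin n) (p : MvPolynomial (Fin n) ℂ) :
    pderiv i (pderiv j p) = pderiv j (pderiv i p) := by
  classical
  ext m
  rw [coeff_pderiv, coeff_pderiv, coeff_pderiv, coeff_pderiv, add_right_comm]
  by_cases h : i = j
  · subst h; ring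
  · simp [h, Ne.symm h]
    ring

/-- The algebra morphism `p ↦ p(∂)` to the differential operators with constant coefficients. -/
def diffOp (n : ℕ) : MvPolynomial (Fin n) ℂ →ₐ[ℂ] Module.End ℂ (MvPolynomial (Fin n) ℂ) :=
  let D : Fin n → Module.End ℂ (MvPolynomial (Fin n) ℂ) := fun i => (pderiv i).toLinearMap
  have hD : ∀ a ∈ Set.range D, ∀ b ∈ Set.range D, a * b = b * a := by
    rintro _ ⟨i, rfl⟩ _ ⟨j, rfl⟩
    exact LinearMap.ext fun p => pderiv_pderiv_comm i j p
  -- `aeval` needs a commutative target, so it goes through the subalgebra generated by the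
  -- commuting ∂_i.
  haveI := Algebra.isMulCommutative_adjoin ℂ hD
  (Subalgebra.val (Algebra.adjoin ℂ (Set.range D))).comp
    (aeval fun i => (⟨D i, Algebra.subset_adjoin ⟨i, rfl⟩⟩ : Algebra.adjoin ℂ (Set.range D)))

theorem diffOp_X {n : ℕ} (i : Fin n) : diffOp n (X i) = (pderiv i).toLinearMap := by
  simp [diffOp]

theorem diffOp_monomial {n : ℕ} (α : Fin n →₀ ℕ) (ω : MvPolynomial (Fin n) ℂ) :
    diffOp n (monomial α 1) ω = iterPDeriv α ω := by
  have h : (monomial α (1 : ℂ)) =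
      (List.ofFn fun i : Fin n => (X i : MvPolynomial (Fin n) ℂ) ^ α i).prod := by
    rw [List.prod_ofFn, monomial_eq, C_1, one_mul, Finsupp.prod_fintype _ _ (by simp)]
  rw [h, map_list_prod, List.map_ofFn, iterPDeriv]
  congr 3
  ext1 i
  simp [diffOp_X]

/-- The substitution `p ↦ p(x + ξ)`. -/
def shift {n : ℕ} (ξ : Fin n → ℂ) : MvPolynomial (Fin n) ℂ →ₐ[ℂ] MvPolynomial (Fin n) ℂ :=
  aeval fun i => X i + C (ξ i)

theorem shift_surjective {n : ℕ} (ξ : Fin n → ℂ) : Function.Surjective (shift ξ) := by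
  intro p
  refine ⟨shift (-ξ) p, ?_⟩
  have h : (shift ξ).comp (shift (-ξ)) = AlgHom.id ℂ _ := by
    ext1 i
    simp [shift]
  exact DFunLike.congr_fun h p

/-- The algebra morphism `p ↦ p(∂ + ξ)`. -/
def twistedDiffOp {n : ℕ} (ξ : Fin n → ℂ) :
    MvPolynomial (Fin n) ℂ →ₐ[ℂ] Module.End ℂ (MvPolynomial (Fin n) ℂ) :=
  (diffOp n).comp (shift ξ)

theorem twistedDiffOp_X {n : ℕ} (ξ : Fin n → ℂ) (j : Fin n) (ω : MvPolynomial (Fin n) ℂ) :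
    twistedDiffOp ξ (X j) ω = pderiv j ω + C (ξ j) * ω := by
  rw [twistedDiffOp, AlgHom.comp_apply, shift, aeval_X, map_add, diffOp_X, ← algebraMap_eq,
    AlgHom.commutes, LinearMap.add_apply, Module.algebraMap_end_apply, algebraMap_eq, ← smul_eq_C_mul]
  rfl

theorem twistedDiffOp_mul_apply {n : ℕ} (ξ : Fin n → ℂ) (p q ω : MvPolynomial (Fin n) ℂ) :
    twistedDiffOp ξ (p * q) ω = twistedDiffOp ξ p (twistedDiffOp ξ q ω) := by
  rw [map_mul, Module.End.mul_apply]

/-- The substitution x ↦ x + ξ is onto, so the operators p(∂ + ξ) are the same as the p(∂); hence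
the range does not depend on ξ. -/
theorem range_twistedDiffOp {n : ℕ} (ξ : Fin n → ℂ) (ω : MvPolynomial (Fin n) ℂ) :
    LinearMap.range ((LinearMap.applyₗ ω).comp (twistedDiffOp ξ).toLinearMap) =
      Submodule.span ℂ (Set.range fun α : Fin n →₀ ℕ => iterPDeriv α ω) := by
  have h : (LinearMap.applyₗ ω).comp (twistedDiffOp ξ).toLinearMap =
      ((LinearMap.applyₗ ω).comp (diffOp n).toLinearMap).comp (shift ξ).toLinearMap := rfl
  rw [h, LinearMap.range_comp_of_range_eq_top _ (LinearMap.range_eq_top.mpr (shift_surjective ξ)),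
    LinearMap.range_eq_map, ← (basisMonomials (Fin n) ℂ).span_eq, Submodule.map_span,
    ← Set.range_comp]
  congr 2
  ext1 α
  simp [← diffOp_monomial]

theorem coeff_pderiv_pow_eq_zero {n : ℕ} (j : Fin n) (k : ℕ) (ω : MvPolynomial (Fin n) ℂ)
    (m : Fin n →₀ ℕ) (h : coeff (m + Finsupp.single j k) ω = 0) :
    coeff m (((pderiv j).toLinearMap ^ k : Module.End ℂ (MvPolynomial (Fin n) ℂ)) ω) = 0 := by
  induction k generalizing m with
  | zero => simpa using h
  | succ k ih =>
    rw [pow_succ', Module.End.mul_apply]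
    change coeff m (pderiv j _) = 0
    rw [coeff_pderiv, ih, zero_mul]
    rwa [add_assoc, ← Finsupp.single_add, add_comm 1 k]

theorem exists_pderiv_pow_eq_zero {n : ℕ} (j : Fin n) (ω : MvPolynomial (Fin n) ℂ) :
    ∃ k, ((pderiv j).toLinearMap ^ k : Module.End ℂ (MvPolynomial (Fin n) ℂ)) ω = 0 := by
  refine ⟨ω.totalDegree + 1, ?_⟩
  ext m
  refine coeff_pderiv_pow_eq_zero j _ ω m (coeff_eq_zero_of_totalDegree_lt ?_)
  change _ < (m + Finsupp.single j (ω.totalDegree + 1)).degree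
  rw [map_add, Finsupp.degree_single]
  omega

/-- A polynomial is zero if all the operators `p(∂ + ξ)` map it to polynomials without constant
coefficient. -/
theorem eq_zero_of_constantCoeff_twistedDiffOp {n : ℕ} (ξ : Fin n → ℂ) (u : MvPolynomial (Fin n) ℂ)
    (h : ∀ q, constantCoeff (twistedDiffOp ξ q u) = 0) : u = 0 := by
  ext α
  rw [coeff_zero]
  -- The hypothesis passes from u to ∂_j u, because ∂_j is the operator of X_j - ξ_j. The
  -- coefficient of u at α, times α_j ≠ 0, is that of ∂_j u at α - e_j.
  induction hd : α.degree generalizing α u with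
  | zero =>
    have := h 1
    rw [(Finsupp.degree_eq_zero_iff α).mp hd]
    simpa [constantCoeff_eq] using this
  | succ d ih =>
    have hα : α ≠ 0 := by rintro rfl; simp at hd
    obtain ⟨j, hj⟩ := Finsupp.ne_iff.mp hα
    have hα' : α - Finsupp.single j 1 + Finsupp.single j 1 = α :=
      Finsupp.sub_add_single_one_cancel hj
    have hc : coeff (α - Finsupp.single j 1) (pderiv j u) = 0 := by
      refine ih (pderiv j u) (fun q => ?_) _ ?_
      · have hx : pderiv j u = twistedDiffOp ξ (X j - C (ξ j)) u := by
          rw [map_sub, LinearMap.sub_apply, twistedDiffOp_X, ← algebraMap_eq, AlgHom.commutes,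
            Module.algebraMap_end_apply, algebraMap_eq, ← smul_eq_C_mul, add_sub_cancel_right]
        rw [hx, ← twistedDiffOp_mul_apply]
        exact h _
      · have := congrArg Finsupp.degree hα'
        rw [map_add, Finsupp.degree_single] at this
        omega
    rw [coeff_pderiv, hα'] at hc
    exact (mul_eq_zero.mp hc).resolve_right (Nat.cast_add_one_ne_zero _)

/-! ### The functional of a polynomial-exponential series -/

theorem multiFactorial_add_single {n : ℕ} (β : Fin n →₀ ℕ) (j : Fin n) :
    multiFactorial (β + Finsupp.single j 1) = (β j + 1) * multiFactorial β := by
  unfold multiFactorial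
  rw [← Finset.mul_prod_erase _ _ (Finset.mem_univ j), ← Finset.mul_prod_erase Finset.univ
    (fun i => (β i).factorial) (Finset.mem_univ j), ← mul_assoc]
  congr 1
  · simp [Nat.factorial_succ]
  · refine Finset.prod_congr rfl fun i hi => ?_
    simp [(Finset.ne_of_mem_erase hi)]

/-- Both sides shift the moments by e_j: the factor α! in the moments absorbs the integer produced
by differentiation. -/
theorem starAct_X {n : ℕ} (j : Fin n) (σ : MvPowerSeries (Fin n) ℂ) :
    starAct (X j) σ = MvPowerSeries.pderiv ℂ j σ := by
  ext β
  rw [MvPowerSeries.coeff_pderiv]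
  change pairing σ (X j * monomial β 1) / (multiFactorial β : ℂ) = _
  rw [X, monomial_mul, one_mul, pairing_monomial, moment, add_comm, multiFactorial_add_single,
    div_eq_iff (multiFactorial_ne_zero β)]
  push_cast
  ring

theorem coeff_expSeries {n : ℕ} (ξ : Fin n → ℂ) (β : Fin n →₀ ℕ) :
    MvPowerSeries.coeff β (expSeries ξ) = (∏ i, ξ i ^ β i) / (multiFactorial β : ℂ) := rfl

theorem pderiv_expSeries {n : ℕ} (j : Fin n) (ξ : Fin n → ℂ) :
    MvPowerSeries.pderiv ℂ j (expSeries ξ) = MvPowerSeries.C (ξ j) * expSeries ξ := by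
  ext β
  rw [MvPowerSeries.coeff_pderiv, MvPowerSeries.coeff_C_mul, coeff_expSeries, coeff_expSeries]
  have h1 : ∏ i, ξ i ^ (β + Finsupp.single j 1 : Fin n →₀ ℕ) i = ξ j * ∏ i, ξ i ^ β i := by
    simp only [Finsupp.add_apply, pow_add, Finset.prod_mul_distrib]
    rw [mul_comm, Finset.prod_eq_single j (fun i _ hi => by simp [hi]) (by simp)]
    simp
  have h2 : (β j + 1 : ℂ) ≠ 0 := Nat.cast_add_one_ne_zero _
  rw [h1, multiFactorial_add_single]
  have h3 := multiFactorial_ne_zero β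
  push_cast
  field_simp

theorem starAct_X_mul_expSeries {n : ℕ} (j : Fin n) (ω : MvPolynomial (Fin n) ℂ) (ξ : Fin n → ℂ) :
    starAct (X j) ((ω : MvPowerSeries (Fin n) ℂ) * expSeries ξ) =
      (twistedDiffOp ξ (X j) ω : MvPolynomial (Fin n) ℂ) * expSeries ξ := by
  rw [starAct_X, Derivation.leibniz, pderiv_expSeries, MvPowerSeries.pderiv_coe, twistedDiffOp_X,
    coe_add, coe_mul, coe_C, smul_eq_mul, smul_eq_mul]
  ring

theorem pairing_one {n : ℕ} (σ : MvPowerSeries (Fin n) ℂ) :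
    pairing σ 1 = MvPowerSeries.constantCoeff σ := by
  rw [show (1 : MvPolynomial (Fin n) ℂ) = monomial 0 1 from rfl, pairing_monomial, moment]
  simp [multiFactorial]

/-- Induction on p: a factor X_j is moved onto the series, where it becomes ∂_j + ξ_j acting on ω.
For constants, e_ξ has constant term 1. -/
theorem pairing_mul_expSeries {n : ℕ} (ξ : Fin n → ℂ) (p ω : MvPolynomial (Fin n) ℂ) :
    pairing ((ω : MvPowerSeries (Fin n) ℂ) * expSeries ξ) p =
      constantCoeff (twistedDiffOp ξ p ω) := by
  induction p using MvPolynomial.induction_on generalizing ω with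
  | C a =>
    have h1 : MvPowerSeries.constantCoeff (expSeries ξ) = 1 := by
      rw [← MvPowerSeries.coeff_zero_eq_constantCoeff_apply, coeff_expSeries]
      simp [multiFactorial]
    have h2 : MvPowerSeries.constantCoeff (ω : MvPowerSeries (Fin n) ℂ) = constantCoeff ω := by
      rw [← MvPowerSeries.coeff_zero_eq_constantCoeff_apply, coeff_coe, constantCoeff_eq]
    rw [← algebraMap_eq, AlgHom.commutes, Module.algebraMap_end_apply, algebraMap_eq,
      ← mul_one (C a), ← smul_eq_C_mul, map_smul, pairing_one, map_mul, h1, h2, mul_one, smul_eq_mul,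
      smul_eq_C_mul, map_mul, constantCoeff_C]
  | add p q hp hq => rw [map_add, hp, hq, map_add, LinearMap.add_apply, map_add]
  | mul_X p j hp =>
    rw [mul_comm p, ← pairing_starAct, starAct_X_mul_expSeries, hp, mul_comm (X j),
      twistedDiffOp_mul_apply]

theorem moment_add {n : ℕ} (σ τ : MvPowerSeries (Fin n) ℂ) :
    moment (σ + τ) = moment σ + moment τ := by
  ext α
  simp [moment, mul_add]

theorem pairing_polyExp {n r : ℕ} (ω : Fin r → MvPolynomial (Fin n) ℂ) (ξ : Fin r → Fin n → ℂ)
    (p : MvPolynomial (Fin n) ℂ) :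
    pairing (polyExp ω ξ) p = ∑ i, constantCoeff (twistedDiffOp (ξ i) p (ω i)) := by
  let L : MvPowerSeries (Fin n) ℂ →+ ℂ :=
    { toFun := fun σ => pairing σ p
      map_zero' := by
        have h : moment (0 : MvPowerSeries (Fin n) ℂ) = 0 := by ext α; simp [moment]
        simp [pairing, h]
      map_add' := fun σ τ => by
        simp only [pairing, moment_add, map_add, LinearMap.add_apply] }
  change L _ = _
  rw [polyExp, map_sum]
  exact Finset.sum_congr rfl fun i _ => pairing_mul_expSeries (ξ i) p (ω i)

/-! ### The local algebra at a point -/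

/-- The ideal of the polynomials `p` with `p(∂ + ξ) ω = 0`. -/
def annIdeal {n : ℕ} (ξ : Fin n → ℂ) (ω : MvPolynomial (Fin n) ℂ) :
    Ideal (MvPolynomial (Fin n) ℂ) where
  carrier := {p | twistedDiffOp ξ p ω = 0}
  zero_mem' := by simp
  add_mem' := fun {a b} (ha : _ = _) (hb : _ = _) => by
    simp only [Set.mem_ofPred_eq, map_add, LinearMap.add_apply, ha, hb, add_zero]
  smul_mem' := fun c a (ha : _ = _) => by
    simp only [Set.mem_ofPred_eq, smul_eq_mul, twistedDiffOp_mul_apply, ha, map_zero]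

theorem mem_annIdeal {n : ℕ} {ξ : Fin n → ℂ} {ω p : MvPolynomial (Fin n) ℂ} :
    p ∈ annIdeal ξ ω ↔ twistedDiffOp ξ p ω = 0 := Iff.rfl

theorem annIdeal_ne_top {n : ℕ} (ξ : Fin n → ℂ) {ω : MvPolynomial (Fin n) ℂ} (hω : ω ≠ 0) :
    annIdeal ξ ω ≠ ⊤ := by
  rw [Ideal.ne_top_iff_one, mem_annIdeal, map_one]
  exact hω

theorem exists_X_sub_C_pow_mem_annIdeal {n : ℕ} (ξ : Fin n → ℂ) (ω : MvPolynomial (Fin n) ℂ)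
    (j : Fin n) : ∃ k, (X j - C (ξ j)) ^ k ∈ annIdeal ξ ω := by
  obtain ⟨k, hk⟩ := exists_pderiv_pow_eq_zero j ω
  refine ⟨k, ?_⟩
  have h : twistedDiffOp ξ (X j - C (ξ j)) = (pderiv j).toLinearMap := by
    rw [twistedDiffOp, AlgHom.comp_apply, ← diffOp_X]
    congr 1
    simp [shift]
  rw [mem_annIdeal, map_pow, h, hk]

/-- Modulo an ideal containing all `X j - ξ j`, a polynomial is congruent to its value at `ξ`. -/
theorem sub_C_eval_mem {n : ℕ} {ξ : Fin n → ℂ} {J : Ideal (MvPolynomial (Fin n) ℂ)}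
    (hJ : ∀ j, X j - C (ξ j) ∈ J) (g : MvPolynomial (Fin n) ℂ) : g - C (eval ξ g) ∈ J := by
  have h : Ideal.Quotient.mkₐ ℂ J = (Algebra.ofId ℂ _).comp (aeval ξ) := by
    ext1 j
    rw [AlgHom.comp_apply, aeval_X]
    exact Ideal.Quotient.eq.mpr (hJ j)
  have hg := DFunLike.congr_fun h g
  rw [AlgHom.comp_apply, aeval_eq_eval] at hg
  exact Ideal.Quotient.eq.mp hg

theorem X_sub_C_mem_radical_annIdeal {n : ℕ} (ξ : Fin n → ℂ) (ω : MvPolynomial (Fin n) ℂ)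
    (j : Fin n) : X j - C (ξ j) ∈ (annIdeal ξ ω).radical :=
  exists_X_sub_C_pow_mem_annIdeal ξ ω j

/-- The radical contains every X_j - ξ_j, hence g - g(ξ). -/
theorem isNilpotent_mk_annIdeal {n : ℕ} (ξ : Fin n → ℂ) (ω g : MvPolynomial (Fin n) ℂ) :
    IsNilpotent (Ideal.Quotient.mk (annIdeal ξ ω) (g - C (eval ξ g))) := by
  obtain ⟨k, hk⟩ := sub_C_eval_mem (X_sub_C_mem_radical_annIdeal ξ ω) g
  exact ⟨k, by rw [← map_pow, Ideal.Quotient.eq_zero_iff_mem.mpr hk]⟩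

theorem eval_eq_zero_of_mem_annIdeal {n : ℕ} {ξ : Fin n → ℂ} {ω : MvPolynomial (Fin n) ℂ}
    (hω : ω ≠ 0) {p : MvPolynomial (Fin n) ℂ} (hp : p ∈ annIdeal ξ ω) : eval ξ p = 0 := by
  by_contra h
  have h1 := sub_C_eval_mem (X_sub_C_mem_radical_annIdeal ξ ω) p
  have h2 : C (eval ξ p) ∈ (annIdeal ξ ω).radical := by
    simpa using sub_mem (Ideal.le_radical hp) h1
  refine annIdeal_ne_top ξ hω (Ideal.radical_eq_top.mp (Ideal.eq_top_of_isUnit_mem _ h2 ?_))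
  -- A nonzero value of p at ξ would be a unit in the radical of a proper ideal.
  exact (isUnit_iff_ne_zero.mpr h).map C

/-- The quotient by `annIdeal ξ ω` is the space spanned by the derivatives of `ω`. -/
def quotientAnnIdealEquiv {n : ℕ} (ξ : Fin n → ℂ) (ω : MvPolynomial (Fin n) ℂ) :
    (MvPolynomial (Fin n) ℂ ⧸ annIdeal ξ ω) ≃ₗ[ℂ]
      Submodule.span ℂ (Set.range fun α : Fin n →₀ ℕ => iterPDeriv α ω) :=
  ((Submodule.Quotient.restrictScalarsEquiv ℂ (annIdeal ξ ω)).symm.trans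
    (Submodule.quotEquivOfEq _
      (LinearMap.ker ((LinearMap.applyₗ ω).comp (twistedDiffOp ξ).toLinearMap)) rfl)).trans
    ((LinearMap.quotKerEquivRange _).trans (LinearEquiv.ofEq _ _ (range_twistedDiffOp ξ ω)))

theorem finrank_quotient_annIdeal {n : ℕ} (ξ : Fin n → ℂ) (ω : MvPolynomial (Fin n) ℂ) :
    Module.finrank ℂ (MvPolynomial (Fin n) ℂ ⧸ annIdeal ξ ω) = mult ω :=
  (quotientAnnIdealEquiv ξ ω).finrank_eq

/-- Every class is a scalar plus a nilpotent, hence integral, and a finitely generated integral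
algebra is finite. -/
instance finite_quotient_annIdeal {n : ℕ} (ξ : Fin n → ℂ) (ω : MvPolynomial (Fin n) ℂ) :
    Module.Finite ℂ (MvPolynomial (Fin n) ℂ ⧸ annIdeal ξ ω) := by
  have hint : Algebra.IsIntegral ℂ (MvPolynomial (Fin n) ℂ ⧸ annIdeal ξ ω) := by
    refine ⟨fun a => ?_⟩
    obtain ⟨g, rfl⟩ := Ideal.Quotient.mk_surjective a
    obtain ⟨k, hk⟩ := isNilpotent_mk_annIdeal ξ ω g
    have h1 : IsIntegral ℂ (Ideal.Quotient.mk (annIdeal ξ ω) (g - C (eval ξ g))) :=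
      ⟨Polynomial.X ^ k, Polynomial.monic_X_pow k, by simpa using hk⟩
    have h2 : IsIntegral ℂ (Ideal.Quotient.mk (annIdeal ξ ω) (C (eval ξ g))) :=
      isIntegral_algebraMap (x := eval ξ g)
    rw [← sub_add_cancel g (C (eval ξ g)), map_add]
    exact h1.add h2
  exact Algebra.IsIntegral.finite

theorem mult_pos {n : ℕ} {ω : MvPolynomial (Fin n) ℂ} (hω : ω ≠ 0) : 0 < mult ω := by
  -- Any point would do, since `mult` does not depend on it.
  rw [← finrank_quotient_annIdeal 0 ω]
  have := Ideal.Quotient.nontrivial_iff.mpr (annIdeal_ne_top 0 hω)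
  exact Module.finrank_pos

/-! ### Decomposition of A_σ by the Chinese remainder theorem -/

/-- In a coordinate j that separates the points, X_j - ξ_j and X_j - ζ_j differ by a nonzero
constant, so their powers are coprime; each ideal contains such a power. -/
theorem isCoprime_annIdeal {n : ℕ} {ξ ζ : Fin n → ℂ} (h : ξ ≠ ζ)
    (ω τ : MvPolynomial (Fin n) ℂ) : IsCoprime (annIdeal ξ ω) (annIdeal ζ τ) := by
  obtain ⟨j, hj⟩ := Function.ne_iff.mp h
  obtain ⟨a, ha⟩ := exists_X_sub_C_pow_mem_annIdeal ξ ω j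
  obtain ⟨b, hb⟩ := exists_X_sub_C_pow_mem_annIdeal ζ τ j
  have hc : IsCoprime (X j - C (ξ j) : MvPolynomial (Fin n) ℂ) (X j - C (ζ j)) := by
    refine ⟨-C (ξ j - ζ j)⁻¹, C (ξ j - ζ j)⁻¹, ?_⟩
    have : C (ξ j - ζ j)⁻¹ * (C (ξ j) - C (ζ j)) = (1 : MvPolynomial (Fin n) ℂ) := by
      rw [← C_sub, ← C_mul, inv_mul_cancel₀ (sub_ne_zero.mpr hj), C_1]
    linear_combination this
  obtain ⟨u, v, huv⟩ := hc.pow (m := a) (n := b)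
  exact Ideal.isCoprime_iff_exists.mpr
    ⟨_, Ideal.mul_mem_left _ u ha, _, Ideal.mul_mem_left _ v hb, huv⟩

theorem pairwise_isCoprime_annIdeal {n r : ℕ} (ω : Fin r → MvPolynomial (Fin n) ℂ)
    {ξ : Fin r → Fin n → ℂ} (hξ : Function.Injective ξ) :
    Pairwise (Function.onFun IsCoprime fun i => annIdeal (ξ i) (ω i)) :=
  fun _ _ hij => isCoprime_annIdeal (hξ.ne hij) _ _

theorem hankelIdeal_polyExp {n r : ℕ} (ω : Fin r → MvPolynomial (Fin n) ℂ)
    {ξ : Fin r → Fin n → ℂ} (hξ : Function.Injective ξ) :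
    hankelIdeal (polyExp ω ξ) = ⨅ i, annIdeal (ξ i) (ω i) := by
  ext p
  rw [Ideal.mem_iInf]
  constructor
  · intro hp i
    refine eq_zero_of_constantCoeff_twistedDiffOp (ξ i) _ fun q => ?_
    classical
    -- Since e is 1 modulo the i-th ideal and 0 modulo the others, testing p against q e isolates
    -- the i-th summand of the pairing.
    obtain ⟨e, he⟩ := Ideal.exists_forall_sub_mem_ideal (pairwise_isCoprime_annIdeal ω hξ)
      (Pi.single i 1)
    have h0 := hp (q * e)
    rw [pairing_polyExp, Finset.sum_eq_single i] at h0
    · rw [← twistedDiffOp_mul_apply, mul_comm q]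
      have hi : p * q * (e - 1) ∈ annIdeal (ξ i) (ω i) :=
        Ideal.mul_mem_left _ _ (by simpa using he i)
      rw [mul_sub, mul_one, mul_assoc, mem_annIdeal, map_sub, LinearMap.sub_apply, sub_eq_zero] at hi
      rw [← hi, h0]
    · intro j _ hj
      have hj' : p * (q * e) ∈ annIdeal (ξ j) (ω j) := by
        rw [← mul_assoc]
        exact Ideal.mul_mem_left _ _ (by simpa [hj] using he j)
      rw [mem_annIdeal.mp hj', map_zero]
    · simp
  · intro hp q
    rw [pairing_polyExp]
    refine Finset.sum_eq_zero fun i _ => ?_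
    rw [mem_annIdeal.mp (Ideal.mul_mem_right q _ (hp i)), map_zero]

/-- The decomposition of `A_σ` into local algebras. -/
def hankelAlgebraEquiv {n r : ℕ} (ω : Fin r → MvPolynomial (Fin n) ℂ)
    {ξ : Fin r → Fin n → ℂ} (hξ : Function.Injective ξ) :
    HankelAlgebra (polyExp ω ξ) ≃+* ∀ i, MvPolynomial (Fin n) ℂ ⧸ annIdeal (ξ i) (ω i) :=
  (Ideal.quotEquivOfEq (hankelIdeal_polyExp ω hξ)).trans
    (Ideal.quotientInfRingEquivPiQuotient _ (pairwise_isCoprime_annIdeal ω hξ))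

/-- `hankelAlgebraEquiv` as a linear map. -/
def hankelAlgebraLinearEquiv {n r : ℕ} (ω : Fin r → MvPolynomial (Fin n) ℂ)
    {ξ : Fin r → Fin n → ℂ} (hξ : Function.Injective ξ) :
    HankelAlgebra (polyExp ω ξ) ≃ₗ[ℂ] ∀ i, MvPolynomial (Fin n) ℂ ⧸ annIdeal (ξ i) (ω i) :=
  { (hankelAlgebraEquiv ω hξ).toAddEquiv with
    map_smul' := fun c a => by
      obtain ⟨p, rfl⟩ := Ideal.Quotient.mk_surjective a
      rfl }

theorem finite_hankelAlgebra {n r : ℕ} (ω : Fin r → MvPolynomial (Fin n) ℂ)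
    {ξ : Fin r → Fin n → ℂ} (hξ : Function.Injective ξ) :
    Module.Finite ℂ (HankelAlgebra (polyExp ω ξ)) :=
  Module.Finite.equiv (hankelAlgebraLinearEquiv ω hξ).symm

/-! ### Characteristic polynomials of multiplication operators -/

theorem charpoly_eq_of_isNilpotent_sub {K M : Type*} [Field K] [AddCommGroup M] [Module K M]
    [Module.Finite K M] {f : Module.End K M} {c : K}
    (h : IsNilpotent (f - algebraMap K (Module.End K M) c)) :
    f.charpoly = (Polynomial.X - Polynomial.C c) ^ Module.finrank K M := by
  let b := Module.finBasis K M
  have h1 := h.charpoly_eq_X_pow_finrank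
  have h2 : LinearMap.toMatrix b b (algebraMap K (Module.End K M) c) = Matrix.scalar _ c := by
    rw [Module.algebraMap_end_eq_smul_id, map_smul, LinearMap.toMatrix_id]
    exact Matrix.smul_one_eq_diagonal c
  rw [← LinearMap.charpoly_toMatrix _ b, map_sub, h2, Matrix.charpoly_sub_scalar,
    LinearMap.charpoly_toMatrix] at h1
  -- Here h1 says χ_f(X + c) = X^d; substituting X - c for X recovers χ_f.
  have h3 := congrArg (fun p => p.comp (Polynomial.X - Polynomial.C c)) h1
  simpa [Polynomial.comp_assoc] using h3

theorem charpoly_mulLeft_annIdeal {n : ℕ} (ξ : Fin n → ℂ) (ω g : MvPolynomial (Fin n) ℂ) :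
    (LinearMap.mulLeft ℂ (Ideal.Quotient.mk (annIdeal ξ ω) g)).charpoly =
      (Polynomial.X - Polynomial.C (eval ξ g)) ^ mult ω := by
  rw [← finrank_quotient_annIdeal ξ ω]
  apply charpoly_eq_of_isNilpotent_sub
  obtain ⟨k, hk⟩ := isNilpotent_mk_annIdeal ξ ω g
  refine ⟨k, ?_⟩
  have h : LinearMap.mulLeft ℂ (Ideal.Quotient.mk (annIdeal ξ ω) g) -
      algebraMap ℂ (Module.End ℂ (MvPolynomial (Fin n) ℂ ⧸ annIdeal ξ ω)) (eval ξ g) =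
      LinearMap.mulLeft ℂ (Ideal.Quotient.mk (annIdeal ξ ω) (g - C (eval ξ g))) := by
    refine LinearMap.ext fun a => ?_
    obtain ⟨p, rfl⟩ := Ideal.Quotient.mk_surjective a
    rw [LinearMap.sub_apply, Module.algebraMap_end_apply, LinearMap.mulLeft_apply,
      LinearMap.mulLeft_apply, map_sub, sub_mul, ← map_mul _ (C _), ← smul_eq_C_mul]
    rfl
  rw [h, LinearMap.pow_mulLeft, hk, LinearMap.mulLeft_zero_eq_zero]

theorem charpoly_pi {K : Type*} [Field K] {r : ℕ} {M : Fin r → Type*} [∀ i, AddCommGroup (M i)]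
    [∀ i, Module K (M i)] [∀ i, Module.Finite K (M i)] (f : ∀ i, Module.End K (M i)) :
    (LinearMap.pi fun i => (f i).comp (LinearMap.proj i)).charpoly = ∏ i, (f i).charpoly := by
  classical
  let b := fun i => Module.finBasis K (M i)
  let A := LinearMap.toMatrix (Pi.basis b) (Pi.basis b)
    (LinearMap.pi fun i => (f i).comp (LinearMap.proj i))
  have hA : ∀ x y, A x y =
      (b x.1).repr (f x.1 (Pi.single (M := M) y.1 (b y.1 y.2) x.1)) x.2 := by
    rintro ⟨i, k⟩ ⟨j, l⟩
    refine (LinearMap.toMatrix_apply _ _ _ _ _).trans ?_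
    rw [Pi.basis_repr, Pi.basis_apply]
    rfl
  -- In the product basis the matrix is block diagonal, in particular block triangular.
  have ht : A.BlockTriangular Sigma.fst := fun x y hxy => by
    rw [hA, Pi.single_eq_of_ne hxy.ne', map_zero, map_zero, Finsupp.zero_apply]
  rw [← LinearMap.charpoly_toMatrix _ (Pi.basis b), ht.charpoly,
    Finset.prod_subset (Finset.subset_univ _)]
  · refine Finset.prod_congr rfl fun i _ => ?_
    rw [← LinearMap.charpoly_toMatrix (f i) (b i), 
      ← Matrix.charpoly_reindex (Equiv.sigmaSubtype i)]
    congr 1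
    ext k l
    refine (hA _ _).trans ?_
    rw [LinearMap.toMatrix_apply]
    change (b i).repr (f i (Pi.single (M := M) i (b i l) i)) k = _
    rw [Pi.single_eq_same]
  -- The block formula runs only over indices that carry a basis vector; the others have M i = 0 and
  -- contribute an empty matrix, with characteristic polynomial 1.
  · intro i _ hi
    have : IsEmpty {x : Σ i, Fin (Module.finrank K (M i)) // x.1 = i} :=
      ⟨fun x => hi (Finset.mem_image.mpr ⟨x.1, Finset.mem_univ _, x.2⟩)⟩
    exact Matrix.charpoly_isEmpty

theorem charpoly_mulLeft {n r : ℕ} (ω : Fin r → MvPolynomial (Fin n) ℂ)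
    {ξ : Fin r → Fin n → ℂ} (hξ : Function.Injective ξ) (g : MvPolynomial (Fin n) ℂ)
    [Module.Finite ℂ (HankelAlgebra (polyExp ω ξ))] :
    (LinearMap.mulLeft ℂ (Ideal.Quotient.mk (hankelIdeal (polyExp ω ξ)) g)).charpoly =
      ∏ i, (Polynomial.X - Polynomial.C (eval (ξ i) g)) ^ mult (ω i) := by
  rw [← LinearEquiv.charpoly_conj (hankelAlgebraLinearEquiv ω hξ)]
  have h : (hankelAlgebraLinearEquiv ω hξ).conj
      (LinearMap.mulLeft ℂ (Ideal.Quotient.mk (hankelIdeal (polyExp ω ξ)) g)) =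
      LinearMap.pi fun i => (LinearMap.mulLeft ℂ
        (Ideal.Quotient.mk (annIdeal (ξ i) (ω i)) g)).comp (LinearMap.proj i) := by
    refine LinearMap.ext fun x => ?_
    obtain ⟨a, rfl⟩ := (hankelAlgebraLinearEquiv ω hξ).surjective x
    rw [LinearEquiv.conj_apply_apply, LinearEquiv.symm_apply_apply]
    obtain ⟨p, rfl⟩ := Ideal.Quotient.mk_surjective a
    rfl
  rw [h, charpoly_pi]
  exact Finset.prod_congr rfl fun i _ => charpoly_mulLeft_annIdeal _ _ _

/-! ### Characters of A_σ -/

/-- The kernel of χ is prime and contains a finite intersection, so it contains some `annIdeal (ξ i)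
(ω i)`, then its radical, and thus every g - g(ξ_i). -/
theorem exists_eq_eval_of_hankelIdeal_le_ker {n r : ℕ} (ω : Fin r → MvPolynomial (Fin n) ℂ)
    {ξ : Fin r → Fin n → ℂ} (hξ : Function.Injective ξ) (χ : MvPolynomial (Fin n) ℂ →ₐ[ℂ] ℂ)
    (hχ : hankelIdeal (polyExp ω ξ) ≤ RingHom.ker χ) : ∃ i, ∀ g, χ g = eval (ξ i) g := by
  have hp : (RingHom.ker χ).IsPrime := RingHom.ker_isPrime χ
  rw [hankelIdeal_polyExp ω hξ, ← Finset.inf_univ_eq_iInf, hp.inf_le'] at hχ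
  obtain ⟨i, -, hi⟩ := hχ
  refine ⟨i, fun g => ?_⟩
  have h := hp.radical_le_iff.mpr hi (sub_C_eval_mem (X_sub_C_mem_radical_annIdeal (ξ i) (ω i)) g)
  rw [RingHom.mem_ker, map_sub, sub_eq_zero] at h
  exact h.trans (χ.commutes _)

theorem eval_eq_zero_of_mem_hankelIdeal {n r : ℕ} {ω : Fin r → MvPolynomial (Fin n) ℂ}
    (hω : ∀ i, ω i ≠ 0) {ξ : Fin r → Fin n → ℂ} (hξ : Function.Injective ξ) (i : Fin r)
    {p : MvPolynomial (Fin n) ℂ} (hp : p ∈ hankelIdeal (polyExp ω ξ)) : eval (ξ i) p = 0 := by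
  rw [hankelIdeal_polyExp ω hξ, Ideal.mem_iInf] at hp
  exact eval_eq_zero_of_mem_annIdeal (hω i) (hp i)

/-! ### Hankel matrices as Gram matrices on A_σ -/

/-- The linear functional on `A_σ` induced by `σ`. -/
def quotientPairing {n : ℕ} (σ : MvPowerSeries (Fin n) ℂ) : HankelAlgebra σ →ₗ[ℂ] ℂ :=
  (Submodule.liftQ ((hankelIdeal σ).restrictScalars ℂ) (pairing σ) fun p hp => by
    simpa using hp 1).comp
    (Submodule.Quotient.restrictScalarsEquiv ℂ (hankelIdeal σ)).symm.toLinearMap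

theorem quotientPairing_mk {n : ℕ} (σ : MvPowerSeries (Fin n) ℂ) (p : MvPolynomial (Fin n) ℂ) :
    quotientPairing σ (Ideal.Quotient.mk _ p) = pairing σ p := rfl

/-- The basis of `A_σ` represented by `B`. -/
def IsBasis.basis {n m : ℕ} {σ : MvPowerSeries (Fin n) ℂ} {B : Fin m → MvPolynomial (Fin n) ℂ}
    (hB : IsBasis σ B) : Module.Basis (Fin m) ℂ (HankelAlgebra σ) :=
  Module.Basis.mk hB.linearIndependent hB.span

theorem IsBasis.basis_apply {n m : ℕ} {σ : MvPowerSeries (Fin n) ℂ}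
    {B : Fin m → MvPolynomial (Fin n) ℂ} (hB : IsBasis σ B) (i : Fin m) :
    hB.basis i = Ideal.Quotient.mk _ (B i) :=
  Module.Basis.mk_apply _ _ _

theorem mk_mul_basis {n m : ℕ} {σ : MvPowerSeries (Fin n) ℂ} {B : Fin m → MvPolynomial (Fin n) ℂ}
    (hB : IsBasis σ B) (g : MvPolynomial (Fin n) ℂ) (j : Fin m) :
    Ideal.Quotient.mk (hankelIdeal σ) g * hB.basis j =
      ∑ k, mulMatrix hB g k j • hB.basis k := by
  rw [← hB.basis.sum_repr (Ideal.Quotient.mk (hankelIdeal σ) g * hB.basis j)]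
  refine Finset.sum_congr rfl fun k _ => ?_
  rw [mulMatrix, LinearMap.toMatrix_apply, LinearMap.mulLeft_apply]
  rfl

/-- The transposed matrix describes the action of g on functionals in dual coordinates, which turns
eigenvectors of the transpose into functionals. -/
theorem map_mk_mul_basis {n m : ℕ} {σ : MvPowerSeries (Fin n) ℂ}
    {B : Fin m → MvPolynomial (Fin n) ℂ} (hB : IsBasis σ B) (ℓ : HankelAlgebra σ →ₗ[ℂ] ℂ)
    (g : MvPolynomial (Fin n) ℂ) (j : Fin m) :
    ℓ (Ideal.Quotient.mk (hankelIdeal σ) g * hB.basis j) =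
      (mulMatrix hB g).transpose.mulVec (fun k => ℓ (hB.basis k)) j := by
  rw [mk_mul_basis, map_sum]
  exact Finset.sum_congr rfl fun k _ => map_smul _ _ _

theorem hankelMatrix_apply {n m : ℕ} {σ : MvPowerSeries (Fin n) ℂ}
    {B B' : Fin m → MvPolynomial (Fin n) ℂ} (hB : IsBasis σ B) (hB' : IsBasis σ B') (i j : Fin m) :
    hankelMatrix σ B B' i j = quotientPairing σ (hB.basis i * hB'.basis j) := by
  rw [hB.basis_apply, hB'.basis_apply, ← map_mul, quotientPairing_mk]
  rfl

theorem hankelMatrix_starAct_apply {n m : ℕ} {σ : MvPowerSeries (Fin n) ℂ}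
    {B B' : Fin m → MvPolynomial (Fin n) ℂ} (hB : IsBasis σ B) (hB' : IsBasis σ B')
    (g : MvPolynomial (Fin n) ℂ) (i j : Fin m) :
    hankelMatrix (starAct g σ) B B' i j =
      quotientPairing σ (Ideal.Quotient.mk _ g * hB.basis i * hB'.basis j) := by
  rw [hB.basis_apply, hB'.basis_apply, ← map_mul, ← map_mul, quotientPairing_mk, mul_assoc,
    ← pairing_starAct]
  rfl

theorem hankelMatrix_starAct_eq_mul {n m : ℕ} {σ : MvPowerSeries (Fin n) ℂ}
    {B B' : Fin m → MvPolynomial (Fin n) ℂ} (hB : IsBasis σ B) (hB' : IsBasis σ B')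
    (g : MvPolynomial (Fin n) ℂ) :
    hankelMatrix (starAct g σ) B B' = hankelMatrix σ B B' * mulMatrix hB' g := by
  ext i j
  rw [hankelMatrix_starAct_apply hB hB', mul_comm (Ideal.Quotient.mk _ g), mul_assoc, mk_mul_basis,
    Finset.mul_sum, map_sum, Matrix.mul_apply]
  refine Finset.sum_congr rfl fun k _ => ?_
  rw [mul_smul_comm, map_smul, hankelMatrix_apply hB hB', smul_eq_mul, mul_comm]

theorem hankelMatrix_starAct_eq_transpose_mul {n m : ℕ} {σ : MvPowerSeries (Fin n) ℂ}
    {B B' : Fin m → MvPolynomial (Fin n) ℂ} (hB : IsBasis σ B) (hB' : IsBasis σ B')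
    (g : MvPolynomial (Fin n) ℂ) :
    hankelMatrix (starAct g σ) B B' = (mulMatrix hB g).transpose * hankelMatrix σ B B' := by
  ext i j
  rw [hankelMatrix_starAct_apply hB hB', mk_mul_basis, Finset.sum_mul, map_sum, Matrix.mul_apply]
  refine Finset.sum_congr rfl fun k _ => ?_
  rw [smul_mul_assoc, map_smul, hankelMatrix_apply hB hB', smul_eq_mul, Matrix.transpose_apply]

/-- A kernel vector gives the coordinates of an element a of A_σ with ⟨σ | ab⟩ = 0 for all b; a
representative of a then lies in I_σ, so a = 0. -/
theorem isUnit_det_hankelMatrix {n m : ℕ} {σ : MvPowerSeries (Fin n) ℂ}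
    {B B' : Fin m → MvPolynomial (Fin n) ℂ} (hB : IsBasis σ B) (hB' : IsBasis σ B') :
    IsUnit (hankelMatrix σ B B').det := by
  rw [isUnit_iff_ne_zero]
  intro h0
  obtain ⟨v, hv, hv0⟩ := Matrix.exists_mulVec_eq_zero_iff.mpr h0
  obtain ⟨p, hp⟩ := Ideal.Quotient.mk_surjective (∑ j, v j • hB'.basis j)
  have hz : (quotientPairing σ).comp (LinearMap.mulLeft ℂ (∑ j, v j • hB'.basis j)) = 0 := by
    refine hB.basis.ext fun i => ?_
    have hi := congrFun hv0 i
    rw [LinearMap.comp_apply, LinearMap.mulLeft_apply, mul_comm, Finset.mul_sum, map_sum]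
    refine Eq.trans (Finset.sum_congr rfl fun j _ => ?_) hi
    rw [mul_smul_comm, map_smul, ← hankelMatrix_apply hB hB', smul_eq_mul, mul_comm]
  have hp0 : p ∈ hankelIdeal σ := fun q => by
    rw [← quotientPairing_mk, map_mul, hp]
    exact DFunLike.congr_fun hz (Ideal.Quotient.mk _ q)
  rw [Ideal.Quotient.eq_zero_iff_mem.mpr hp0] at hp
  exact hv (funext (Fintype.linearIndependent_iff.mp hB'.basis.linearIndependent v hp.symm))

/-! ### Pencils of the form (HM, H) -/

/-- HM - tH = H · (-(t - M)), and the sign contributes (-1)^m to the determinant. -/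
theorem pencilPoly_mul {m : ℕ} (H M : Matrix (Fin m) (Fin m) ℂ) :
    pencilPoly (H * M) H = Polynomial.C (H.det * (-1) ^ m) * M.charpoly := by
  have h : (H * M).map Polynomial.C - (Polynomial.X : Polynomial ℂ) • H.map Polynomial.C =
      H.map Polynomial.C * -M.charmatrix := by
    rw [Matrix.charmatrix, neg_sub, mul_sub, Matrix.map_mul, Matrix.scalar_apply,
      ← Matrix.smul_one_eq_diagonal, Matrix.mul_smul, mul_one]
    rfl
  rw [pencilPoly, h, Matrix.det_mul, Matrix.det_neg, Matrix.charpoly, Fintype.card_fin,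
    ← RingHom.mapMatrix_apply, ← RingHom.map_det]
  simp [mul_assoc]

theorem isGenEigenpair_mul_iff {m : ℕ} {H : Matrix (Fin m) (Fin m) ℂ} (hH : IsUnit H.det)
    (M : Matrix (Fin m) (Fin m) ℂ) (z : ℂ) (v : Fin m → ℂ) :
    IsGenEigenpair (H * M) H z v ↔ v ≠ 0 ∧ (Matrix.scalar (Fin m) z - M).mulVec v = 0 := by
  have hinj : Function.Injective H.mulVec :=
    Matrix.mulVec_injective_iff_isUnit.mpr ((Matrix.isUnit_iff_isUnit_det H).mpr hH)
  rw [IsGenEigenpair, ← Matrix.mulVec_mulVec, ← Matrix.mulVec_smul, hinj.eq_iff, Matrix.sub_mulVec,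
    sub_eq_zero, eq_comm, Matrix.scalar_apply, ← Matrix.smul_one_eq_diagonal, Matrix.smul_mulVec,
    Matrix.one_mulVec]

theorem exists_isGenEigenpair_mul_iff {m : ℕ} {H : Matrix (Fin m) (Fin m) ℂ} (hH : IsUnit H.det)
    (M : Matrix (Fin m) (Fin m) ℂ) (z : ℂ) :
    (∃ v, IsGenEigenpair (H * M) H z v) ↔ M.charpoly.eval z = 0 := by
  simp_rw [isGenEigenpair_mul_iff hH]
  rw [Matrix.exists_mulVec_eq_zero_iff, Matrix.eval_charpoly]

theorem charpoly_mulMatrix {n r m : ℕ} (ω : Fin r → MvPolynomial (Fin n) ℂ)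
    {ξ : Fin r → Fin n → ℂ} (hξ : Function.Injective ξ) {B : Fin m → MvPolynomial (Fin n) ℂ}
    (hB : IsBasis (polyExp ω ξ) B) (g : MvPolynomial (Fin n) ℂ) :
    (mulMatrix hB g).charpoly =
      ∏ i, (Polynomial.X - Polynomial.C (eval (ξ i) g)) ^ mult (ω i) := by
  have := finite_hankelAlgebra ω hξ
  rw [← charpoly_mulLeft ω hξ, mulMatrix, LinearMap.charpoly_toMatrix]

/-! ### Common eigenvectors -/

/-- The point `ξ i` as a character of `A_σ`. -/
def quotientEval {n r : ℕ} {ω : Fin r → MvPolynomial (Fin n) ℂ} (hω : ∀ i, ω i ≠ 0)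
    {ξ : Fin r → Fin n → ℂ} (hξ : Function.Injective ξ) (i : Fin r) :
    HankelAlgebra (polyExp ω ξ) →ₐ[ℂ] ℂ :=
  Ideal.Quotient.liftₐ _ (aeval (ξ i)) fun _ hp => eval_eq_zero_of_mem_hankelIdeal hω hξ i hp

theorem quotientEval_mk {n r : ℕ} {ω : Fin r → MvPolynomial (Fin n) ℂ} (hω : ∀ i, ω i ≠ 0)
    {ξ : Fin r → Fin n → ℂ} (hξ : Function.Injective ξ) (i : Fin r)
    (p : MvPolynomial (Fin n) ℂ) :
    quotientEval hω hξ i (Ideal.Quotient.mk _ p) = eval (ξ i) p := rfl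

/-- Evaluation at ξ_i is a character of A_σ with dual coordinates B(ξ_i); its multiplicativity is
the eigenvector equation. -/
theorem transpose_mulMatrix_mulVec_eval {n r m : ℕ} {ω : Fin r → MvPolynomial (Fin n) ℂ}
    (hω : ∀ i, ω i ≠ 0) {ξ : Fin r → Fin n → ℂ} (hξ : Function.Injective ξ)
    {B : Fin m → MvPolynomial (Fin n) ℂ} (hB : IsBasis (polyExp ω ξ) B)
    (g : MvPolynomial (Fin n) ℂ) (i : Fin r) :
    (mulMatrix hB g).transpose.mulVec (fun j => eval (ξ i) (B j)) =
      eval (ξ i) g • fun j => eval (ξ i) (B j) := by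
  have hb : ∀ j, (quotientEval hω hξ i).toLinearMap (hB.basis j) = eval (ξ i) (B j) := fun j => by
    rw [hB.basis_apply]
    rfl
  ext j
  have h := map_mk_mul_basis hB (quotientEval hω hξ i).toLinearMap g j
  simp_rw [hb] at h
  rw [← h, AlgHom.toLinearMap_apply, map_mul, quotientEval_mk, hB.basis_apply, quotientEval_mk]
  rfl

theorem eval_basis_ne_zero {n r m : ℕ} {ω : Fin r → MvPolynomial (Fin n) ℂ}
    (hω : ∀ i, ω i ≠ 0) {ξ : Fin r → Fin n → ℂ} (hξ : Function.Injective ξ)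
    {B : Fin m → MvPolynomial (Fin n) ℂ} (hB : IsBasis (polyExp ω ξ) B) (i : Fin r) :
    (fun j => eval (ξ i) (B j)) ≠ 0 := by
  intro h
  have h0 : (quotientEval hω hξ i).toLinearMap = 0 := hB.basis.ext fun j => by
    rw [hB.basis_apply]
    exact congrFun h j
  have h1 := DFunLike.congr_fun h0 1
  rw [AlgHom.toLinearMap_apply, map_one] at h1
  exact one_ne_zero h1

/-- A common eigenvector of the transposes of the multiplication matrices is a multiple of the
vector of values of the basis at one of the points `ξ i`. -/
theorem exists_eq_smul_eval {n r m : ℕ} (ω : Fin r → MvPolynomial (Fin n) ℂ)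
    {ξ : Fin r → Fin n → ℂ} (hξ : Function.Injective ξ)
    {B : Fin m → MvPolynomial (Fin n) ℂ} (hB : IsBasis (polyExp ω ξ) B) {w : Fin m → ℂ}
    (hw : w ≠ 0) (h : ∀ g, ∃ z : ℂ, (mulMatrix hB g).transpose.mulVec w = z • w) :
    ∃ (i : Fin r) (c : ℂ), c ≠ 0 ∧ w = c • fun j => eval (ξ i) (B j) := by
  choose z hz using h
  -- With w read as a functional ℓ, the eigenvector equations become ℓ(g a) = z(g) ℓ(a).
  let ℓ : HankelAlgebra (polyExp ω ξ) →ₗ[ℂ] ℂ := hB.basis.constr ℂ w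
  have hℓb : ∀ j, ℓ (hB.basis j) = w j := hB.basis.constr_basis ℂ w
  have hℓ : ∀ g a, ℓ (Ideal.Quotient.mk _ g * a) = z g * ℓ a := by
    intro g a
    have hg : ℓ.comp (LinearMap.mulLeft ℂ (Ideal.Quotient.mk _ g)) = z g • ℓ :=
      hB.basis.ext fun j => by
        rw [LinearMap.comp_apply, LinearMap.mulLeft_apply, map_mk_mul_basis]
        simp_rw [hℓb]
        rw [hz, LinearMap.smul_apply, hℓb, Pi.smul_apply]
    exact DFunLike.congr_fun hg a
  have hℓz : ∀ g, ℓ (Ideal.Quotient.mk _ g) = z g * ℓ 1 := fun g => by rw [← hℓ, mul_one]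
  have h1 : ℓ 1 ≠ 0 := fun h1 => hw <| funext fun j => by
    rw [← hℓb, hB.basis_apply, hℓz, h1, mul_zero, Pi.zero_apply]
  -- Normalized by ℓ(1), the functional equals g ↦ z(g), so the eigenvalues themselves form a
  -- character, which vanishes on I_σ.
  let L : MvPolynomial (Fin n) ℂ →ₗ[ℂ] ℂ :=
    (ℓ 1)⁻¹ • ℓ.comp (Ideal.Quotient.mkₐ ℂ (hankelIdeal (polyExp ω ξ))).toLinearMap
  have hL : ∀ g, L g = z g := fun g => by
    change (ℓ 1)⁻¹ * ℓ (Ideal.Quotient.mk _ g) = z g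
    rw [hℓz, mul_comm, mul_inv_cancel_right₀ h1]
  have hL' : ∀ g, L g = (ℓ 1)⁻¹ * ℓ (Ideal.Quotient.mk _ g) := fun g => rfl
  let χ : MvPolynomial (Fin n) ℂ →ₐ[ℂ] ℂ := AlgHom.ofLinearMap L
    (by rw [hL', map_one (Ideal.Quotient.mk _), inv_mul_cancel₀ h1])
    (fun p q => by rw [hL', map_mul, hℓ, mul_left_comm, ← hL', hL p])
  have hχ : ∀ g, χ g = (ℓ 1)⁻¹ * ℓ (Ideal.Quotient.mk _ g) := hL'
  obtain ⟨i, hi⟩ := exists_eq_eval_of_hankelIdeal_le_ker ω hξ χ fun p hp => by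
    rw [RingHom.mem_ker, hχ, Ideal.Quotient.eq_zero_iff_mem.mpr hp, map_zero, mul_zero]
  refine ⟨i, ℓ 1, h1, funext fun j => ?_⟩
  rw [Pi.smul_apply, ← hi, hχ, smul_eq_mul, mul_inv_cancel_left₀ h1, ← hB.basis_apply, hℓb]

end

end Hankel

open Hankel
theorem mainTheorem1 (n r : ℕ) (ω : Fin r → MvPolynomial (Fin n) ℂ) (ξ : Fin r → Fin n → ℂ)
    (hω : ∀ i, ω i ≠ 0) (hξ : Function.Injective ξ) (σ : MvPowerSeries (Fin n) ℂ)
    (hσ : σ = polyExp ω ξ) :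
    Module.Finite ℂ (HankelAlgebra σ) ∧
    ∀ (m : ℕ) (B B' : Fin m → MvPolynomial (Fin n) ℂ) (hB : IsBasis σ B) (hB' : IsBasis σ B'),
      IsUnit (hankelMatrix σ B B').det ∧
      (∀ g : MvPolynomial (Fin n) ℂ,
        mulMatrix hB' g = (hankelMatrix σ B B')⁻¹ * hankelMatrix (starAct g σ) B B' ∧
        (mulMatrix hB g).transpose = hankelMatrix (starAct g σ) B B' * (hankelMatrix σ B B')⁻¹) ∧
      (∀ g : MvPolynomial (Fin n) ℂ,
        (∀ z : ℂ, (∃ v, IsGenEigenpair (hankelMatrix (starAct g σ) B B') (hankelMatrix σ B B') z v) ↔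
          ∃ i, z = MvPolynomial.eval (ξ i) g) ∧
        pencilPoly (hankelMatrix (starAct g σ) B B') (hankelMatrix σ B B') ≠ 0 ∧
        (pencilPoly (hankelMatrix (starAct g σ) B B') (hankelMatrix σ B B')).roots =
          ∑ i, Multiset.replicate (mult (ω i)) (MvPolynomial.eval (ξ i) g)) ∧
      (∀ v : Fin m → ℂ,
        (∀ g : MvPolynomial (Fin n) ℂ, ∃ z : ℂ,
          IsGenEigenpair (hankelMatrix (starAct g σ) B B') (hankelMatrix σ B B') z v) ↔
        ∃ (i : Fin r) (c : ℂ), c ≠ 0 ∧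
          v = c • (hankelMatrix σ B B')⁻¹.mulVec fun j => MvPolynomial.eval (ξ i) (B j)) := by
  subst hσ
  refine ⟨finite_hankelAlgebra ω hξ, fun m B B' hB hB' => ?_⟩
  have hH := isUnit_det_hankelMatrix hB hB'
  refine ⟨hH, fun g => ⟨?_, ?_⟩, fun g => ⟨fun z => ?_, ?_, ?_⟩, fun v => ⟨fun h => ?_, ?_⟩⟩
  · rw [hankelMatrix_starAct_eq_mul hB hB', Matrix.nonsing_inv_mul_cancel_left _ _ hH]
  · rw [hankelMatrix_starAct_eq_transpose_mul hB hB', Matrix.mul_nonsing_inv_cancel_right _ _ hH]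
  · rw [hankelMatrix_starAct_eq_mul hB hB', exists_isGenEigenpair_mul_iff hH,
      charpoly_mulMatrix ω hξ, Polynomial.eval_prod, Finset.prod_eq_zero_iff]
    -- The exponents μ(ω_i) are positive, so each g(ξ_i) really is a root.
    simp [sub_eq_zero, (mult_pos (hω _)).ne']
  · rw [hankelMatrix_starAct_eq_mul hB hB', pencilPoly_mul]
    refine mul_ne_zero ?_ (Matrix.charpoly_monic _).ne_zero
    exact Polynomial.C_ne_zero.mpr (mul_ne_zero hH.ne_zero (by simp))
  · rw [hankelMatrix_starAct_eq_mul hB hB', pencilPoly_mul,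
      Polynomial.roots_C_mul _ (mul_ne_zero hH.ne_zero (by simp)), charpoly_mulMatrix ω hξ,
      Polynomial.roots_prod _ _ (Finset.prod_ne_zero_iff.mpr fun i _ =>
        pow_ne_zero _ (Polynomial.X_sub_C_ne_zero _))]
    simp only [Polynomial.roots_pow, Polynomial.roots_X_sub_C, Multiset.nsmul_singleton]
    rfl
  -- The choice g = 0 serves only to extract v ≠ 0.
  · obtain ⟨-, hv, -⟩ := h 0
    have hw : (hankelMatrix (polyExp ω ξ) B B').mulVec v ≠ 0 := fun h0 =>
      hv (Matrix.eq_zero_of_mulVec_eq_zero hH.ne_zero h0)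
    -- Since H_{g⋆σ} = (M_g^B)ᵀ H, the vector Hv is a common eigenvector of the transposed
    -- multiplication matrices.
    obtain ⟨i, c, hc, hi⟩ := exists_eq_smul_eval ω hξ hB hw fun g => by
      obtain ⟨z, -, hz⟩ := h g
      rw [hankelMatrix_starAct_eq_transpose_mul hB hB', ← Matrix.mulVec_mulVec] at hz
      exact ⟨z, hz⟩
    refine ⟨i, c, hc, ?_⟩
    rw [← Matrix.mulVec_smul, ← hi, Matrix.mulVec_mulVec, Matrix.nonsing_inv_mul _ hH,
      Matrix.one_mulVec]
  · rintro ⟨i, c, hc, rfl⟩ g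
    have hHv : (hankelMatrix (polyExp ω ξ) B B').mulVec
        (c • (hankelMatrix (polyExp ω ξ) B B')⁻¹.mulVec fun j => MvPolynomial.eval (ξ i) (B j)) =
        c • fun j => MvPolynomial.eval (ξ i) (B j) := by
      rw [Matrix.mulVec_smul, Matrix.mulVec_mulVec, Matrix.mul_nonsing_inv _ hH, Matrix.one_mulVec]
    refine ⟨MvPolynomial.eval (ξ i) g, fun h0 => ?_, ?_⟩
    · rw [h0, Matrix.mulVec_zero] at hHv
      exact smul_ne_zero hc (eval_basis_ne_zero hω hξ hB i) hHv.symm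
    · rw [hankelMatrix_starAct_eq_transpose_mul hB hB', ← Matrix.mulVec_mulVec, hHv,
        Matrix.mulVec_smul, transpose_mulMatrix_mulVec_eval hω hξ, smul_comm]
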